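/- Let $X,Y$ be real Hilbert spaces, let $L:X\to Y$ be a bounded linear operator, let $y\in\mathcal R(L)$, and let $x^\dagger\in X$ be the minimum-norm solution of $Lx=y$, that is, $Lx^\dagger=y$ and $\|x^\dagger\|\le\|x\|$ for every $x\in X$ with $Lx=y$. Let $A\mapsto E_A$ be the spectral measure of the self-adjoint operator $L^*L$ and set $e(\lambda)=\|E_{[0,\lambda]}x^\dagger\|^2$ for $\lambda\ge0$. Let $\varphi:[0,\infty)\to[0,\infty)$ be increasing (in the wide sense, i.e. nondecreasing) and continuous, let $\varphi(L^*L)$ be defined by the continuous functional calculus, and let $\nu\in(0,1)$. Then the following two statements are equivalent: (i) There exists a constant $C>0$ such that $e(\lambda)\le C\,\varphi(\lambda)^{2\nu}$ for all $\lambda>0$. (ii) There exists a constant $\tilde C>0$ such that $\langle x^\dagger,x\rangle\le\tilde C\,\|\varphi(L^*L)x\|^{\nu}\,\|x\|^{1-\nu}$ for all $x\in X$. -/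

import Mathlib

open scoped InnerProductSpace
open Polynomial MeasureTheory

namespace RealHilbert

variable {X : Type*} [NormedAddCommGroup X] [InnerProductSpace ℝ X] [CompleteSpace X]

theorem isSelfAdjoint_aeval {T : X →L[ℝ] X} (hT : IsSelfAdjoint T) (p : ℝ[X]) :
    IsSelfAdjoint (aeval T p) := by
  induction p using Polynomial.induction_on' with
  | add p q hp hq => simpa using hp.add hq
  | monomial n a =>
    rw [aeval_monomial, ← Algebra.smul_def]
    exact (IsSelfAdjoint.all a).smul (hT.pow n)

theorem isUnit_aeval_irreducible {T : X →L[ℝ] X} (hT : IsSelfAdjoint T) {q : ℝ[X]}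
    (hq : Irreducible q) (h : ∀ t ∈ spectrum ℝ T, q.eval t ≠ 0) : IsUnit (aeval T q) := by
  by_cases hr : ∃ r, q.IsRoot r
  · obtain ⟨r, hr⟩ := hr
    obtain ⟨a, ha, b, rfl⟩ := natDegree_eq_one.1
      (natDegree_eq_of_degree_eq_some (degree_eq_one_of_irreducible_of_root hq hr))
    have hrs : r ∉ spectrum ℝ T := fun hrs => h r hrs hr
    rw [spectrum.notMem_iff, IsUnit.sub_iff] at hrs
    have hb : b = -(a * r) := by
      have : a * r + b = 0 := by simpa using hr
      linarith
    have : aeval T (C a * Polynomial.X + C b) =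
        algebraMap ℝ (X →L[ℝ] X) a * (T - algebraMap ℝ (X →L[ℝ] X) r) := by
      rw [mul_sub]; simp [hb, sub_eq_add_neg]
    rw [this]
    exact ((isUnit_iff_ne_zero.2 ha).map (algebraMap ℝ (X →L[ℝ] X))).mul hrs
  · push Not at hr
    have hdeg := hq.natDegree_le_two
    obtain ⟨a, b, c, rfl⟩ : ∃ a b c, q = C a * Polynomial.X ^ 2 + C b * Polynomial.X + C c :=
      ⟨_, _, _, q.eq_quadratic_of_degree_le_two (natDegree_le_iff_degree_le.1 hdeg)⟩
    have ha : a ≠ 0 := by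
      rintro rfl
      by_cases hb : b = 0
      · subst hb
        apply hq.not_isUnit
        have hc : c ≠ 0 := by
          rintro rfl
          exact hq.ne_zero (by simp)
        simpa using hc
      · apply hr (-c / b)
        simp [IsRoot]
        field_simp
        ring
    have hd : 0 < a * c - b ^ 2 / 4 := by
      by_contra hd
      obtain ⟨r, hr'⟩ := exists_quadratic_eq_zero (b := b) (c := c) ha
        ⟨√(discrim a b c), (Real.mul_self_sqrt (by unfold discrim; linarith)).symm⟩
      apply hr r
      simp [IsRoot]
      linarith
    have key : ∀ x : X, a * ⟪aeval T (C a * Polynomial.X ^ 2 + C b * Polynomial.X + C c) x, x⟫_ℝ =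
        ‖a • T x + (b / 2) • x‖ ^ 2 + (a * c - b ^ 2 / 4) * ‖x‖ ^ 2 := by
      intro x
      have h1 : ⟪T (T x), x⟫_ℝ = ⟪T x, T x⟫_ℝ := hT.isSymmetric (T x) x
      have h2 : ⟪x, T x⟫_ℝ = ⟪T x, x⟫_ℝ := real_inner_comm _ _
      rw [norm_add_sq_real, norm_smul, norm_smul, mul_pow, mul_pow, Real.norm_eq_abs,
        Real.norm_eq_abs, sq_abs, sq_abs]
      simp [inner_add_left, inner_smul_left, inner_smul_right, pow_two, h1,
        Algebra.algebraMap_eq_smul_one]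
      ring
    have hpos : 0 < (a * c - b ^ 2 / 4) / |a| := div_pos hd (abs_pos.2 ha)
    refine ContinuousLinearMap.isUnit_of_forall_le_norm_inner_map _
      (c := ⟨(a * c - b ^ 2 / 4) / |a|, hpos.le⟩) hpos fun x => ?_
    have hx := key x
    set s := ⟪aeval T (C a * Polynomial.X ^ 2 + C b * Polynomial.X + C c) x, x⟫_ℝ
    have h3 : (a * c - b ^ 2 / 4) * ‖x‖ ^ 2 ≤ |a| * |s| := by
      rw [← abs_mul, hx]
      refine le_trans ?_ (le_abs_self _)
      nlinarith [sq_nonneg ‖a • T x + (b / 2) • x‖]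
    change ‖x‖ ^ 2 * ((a * c - b ^ 2 / 4) / |a|) ≤ |s|
    rw [mul_div_assoc', div_le_iff₀ (abs_pos.2 ha)]
    linarith

theorem isUnit_aeval {T : X →L[ℝ] X} (hT : IsSelfAdjoint T) {q : ℝ[X]} (hq : q ≠ 0)
    (h : ∀ t ∈ spectrum ℝ T, q.eval t ≠ 0) : IsUnit (aeval T q) := by
  induction q using WfDvdMonoid.induction_on_irreducible with
  | zero => exact absurd rfl hq
  | unit u hu => exact hu.map _
  | mul a i ha hi ih =>
    rw [map_mul]
    refine (isUnit_aeval_irreducible hT hi fun t ht h0 => h t ht (by simp [h0])).mul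
      (ih ha fun t ht h0 => h t ht (by simp [h0]))

theorem spectrum_nonempty_of_isSelfAdjoint [Nontrivial X] {T : X →L[ℝ] X} (hT : IsSelfAdjoint T) :
    (spectrum ℝ T).Nonempty := by
  by_contra h
  rw [Set.not_nonempty_iff_eq_empty] at h
  have h1 := T.spectralRadius_eq_nnnorm hT
  rw [spectralRadius, h] at h1
  have h2 : T = 0 := by simpa using h1.symm
  subst h2
  simp [spectrum.zero_eq] at h

theorem spectrum_aeval {T : X →L[ℝ] X} (hT : IsSelfAdjoint T) (p : ℝ[X]) :
    spectrum ℝ (aeval T p) = (fun t => p.eval t) '' spectrum ℝ T := by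
  refine (Set.Subset.antisymm ?_ (spectrum.subset_polynomial_aeval T p))
  intro l hl
  by_contra hcon
  have hne : p - C l ≠ 0 := by
    intro h0
    rw [sub_eq_zero] at h0
    subst h0
    rcases subsingleton_or_nontrivial X with hX | hX
    · exact hl (isUnit_of_subsingleton _)
    · obtain ⟨t, ht⟩ := spectrum_nonempty_of_isSelfAdjoint hT
      exact hcon ⟨t, ht, by simp⟩
  refine spectrum.mem_iff.1 hl ?_
  rw [IsUnit.sub_iff]
  have := isUnit_aeval hT hne fun t ht h0 => hcon ⟨t, ht, by simpa [sub_eq_zero] using h0⟩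
  simpa using this

theorem norm_aeval {T : X →L[ℝ] X} (hT : IsSelfAdjoint T) [CompactSpace (spectrum ℝ T)] (p : ℝ[X]) :
    ‖p.toContinuousMapOn (spectrum ℝ T)‖ = ‖aeval T p‖ := by
  apply le_antisymm
  · rw [ContinuousMap.norm_le _ (norm_nonneg _)]
    intro t
    rcases subsingleton_or_nontrivial X with hX | hX
    · exact absurd (isUnit_of_subsingleton _) t.2
    exact spectrum.norm_le_norm_of_mem (spectrum.subset_polynomial_aeval T p ⟨t, t.2, rfl⟩)
  · have h1 := (aeval T p).spectralRadius_eq_nnnorm (isSelfAdjoint_aeval hT p)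
    have h2 : spectralRadius ℝ (aeval T p) ≤ ‖p.toContinuousMapOn (spectrum ℝ T)‖₊ := by
      refine iSup₂_le fun l hl => ?_
      rw [spectrum_aeval hT] at hl
      obtain ⟨t, ht, rfl⟩ := hl
      exact_mod_cast ContinuousMap.norm_coe_le_norm (p.toContinuousMapOn (spectrum ℝ T)) ⟨t, ht⟩
    rw [h1] at h2
    exact_mod_cast h2

/-- Real self-adjoint operators have a continuous functional calculus `f ↦ f(T)`: it extends
`p ↦ p(T)` isometrically from polynomials to continuous functions on the spectrum. -/
theorem exists_cfc {T : X →L[ℝ] X} (hT : IsSelfAdjoint T) :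
    ∃ Φ : C(spectrum ℝ T, ℝ) →⋆ₐ[ℝ] (X →L[ℝ] X),
      Continuous Φ ∧ Function.Injective Φ ∧
        Φ ((ContinuousMap.id ℝ).restrict (spectrum ℝ T)) = T ∧
          (∀ f, spectrum ℝ (Φ f) = Set.range f) ∧ ∀ f, IsSelfAdjoint (Φ f) := by
  have : CompactSpace (spectrum ℝ T) := isCompact_iff_compactSpace.1 (spectrum.isCompact T)
  let Ψ : ℝ[X] →ₐ[ℝ] C(spectrum ℝ T, ℝ) × (X →L[ℝ] X) :=
    (Polynomial.toContinuousMapOnAlgHom (spectrum ℝ T)).prod (aeval T)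
  let G : Subalgebra ℝ (C(spectrum ℝ T, ℝ) × (X →L[ℝ] X)) := Ψ.range.topologicalClosure
  have hΨ : ∀ p, Ψ p ∈ G := fun p => Subalgebra.le_topologicalClosure _ ⟨p, rfl⟩
  have hclos : ∀ P : C(spectrum ℝ T, ℝ) × (X →L[ℝ] X) → Prop, IsClosed {z | P z} →
      (∀ p, P (Ψ p)) → ∀ z ∈ G, P z := by
    intro P hP hp z hz
    have : closure (Ψ.range : Set (C(spectrum ℝ T, ℝ) × (X →L[ℝ] X))) ⊆ {z | P z} :=
      closure_minimal (by rintro _ ⟨p, rfl⟩; exact hp p) hP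
    exact this hz
  have hnorm : ∀ z ∈ G, ‖z.1‖ = ‖z.2‖ :=
    hclos _ (isClosed_eq (by fun_prop) (by fun_prop)) (norm_aeval hT)
  have hsa : ∀ z ∈ G, star z.2 = z.2 :=
    hclos _ (isClosed_eq (by fun_prop) (by fun_prop)) (isSelfAdjoint_aeval hT)
  have hGclosed : IsClosed (G : Set (C(spectrum ℝ T, ℝ) × (X →L[ℝ] X))) :=
    Subalgebra.isClosed_topologicalClosure _
  let π : G →ₐ[ℝ] C(spectrum ℝ T, ℝ) := (AlgHom.fst ℝ _ _).comp G.val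
  have hπ : Isometry π := by
    refine AddMonoidHomClass.isometry_of_norm π fun z => ?_
    change ‖z.1.1‖ = ‖z.1‖
    rw [Prod.norm_def, hnorm _ z.2, max_self]
  have hbij : Function.Bijective π := by
    refine ⟨hπ.injective, ?_⟩
    have : CompleteSpace G := hGclosed.completeSpace_coe
    have hcl : IsClosed (Set.range π) := hπ.isClosedEmbedding.isClosed_range
    have hd := polynomialFunctions.topologicalClosure (spectrum ℝ T)
    intro f
    have hf : f ∈ (polynomialFunctions (spectrum ℝ T)).topologicalClosure := by
      rw [hd]; trivial
    have hsub : closure (polynomialFunctions (spectrum ℝ T) : Set C(spectrum ℝ T, ℝ)) ⊆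
        Set.range π := by
      refine closure_minimal ?_ hcl
      rw [polynomialFunctions_coe]
      rintro _ ⟨p, rfl⟩
      exact ⟨⟨Ψ p, hΨ p⟩, rfl⟩
    exact hsub hf
  let e : G ≃ₐ[ℝ] C(spectrum ℝ T, ℝ) := AlgEquiv.ofBijective π hbij
  let Φ₀ : C(spectrum ℝ T, ℝ) →ₐ[ℝ] (X →L[ℝ] X) :=
    ((AlgHom.snd ℝ _ _).comp G.val).comp e.symm.toAlgHom
  have he : ∀ f, (e.symm f).1.1 = f := fun f => e.apply_symm_apply f
  have hΦsa : ∀ f, star (Φ₀ f) = Φ₀ f := fun f => hsa _ (e.symm f).2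
  let Φ : C(spectrum ℝ T, ℝ) →⋆ₐ[ℝ] (X →L[ℝ] X) :=
    { Φ₀ with
      map_star' := fun f => by
        change Φ₀ (star f) = star (Φ₀ f)
        rw [hΦsa, star_trivial] }
  have hΦp : ∀ p : ℝ[X], Φ (p.toContinuousMapOn (spectrum ℝ T)) = aeval T p := by
    intro p
    have : e.symm (p.toContinuousMapOn (spectrum ℝ T)) = ⟨Ψ p, hΨ p⟩ := by
      rw [AlgEquiv.symm_apply_eq]; rfl
    change (e.symm (p.toContinuousMapOn (spectrum ℝ T))).1.2 = _
    rw [this]; rfl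
  have hiso : Isometry Φ := by
    refine AddMonoidHomClass.isometry_of_norm Φ fun f => ?_
    change ‖(e.symm f).1.2‖ = _
    rw [← hnorm _ (e.symm f).2, he]
  refine ⟨Φ, hiso.continuous, hiso.injective, ?_, fun f => ?_, hΦsa⟩
  · have := hΦp Polynomial.X
    rw [aeval_X] at this
    refine Eq.trans ?_ this
    congr 1
    ext t
    simp
  · apply Set.Subset.antisymm
    · intro l hl
      by_contra hcon
      apply hl
      have hu : IsUnit (algebraMap ℝ C(spectrum ℝ T, ℝ) l - f) := by
        rw [ContinuousMap.isUnit_iff_forall_ne_zero]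
        intro t ht
        exact hcon ⟨t, (sub_eq_zero.1 ht).symm⟩
      have := hu.map Φ
      rwa [map_sub, AlgHomClass.commutes] at this
    · rintro _ ⟨t, rfl⟩
      by_contra hcon
      have hu : IsUnit (algebraMap ℝ (X →L[ℝ] X) (f t) - Φ f) := by
        simpa [spectrum.notMem_iff] using hcon
      have hopen : IsOpen {g : C(spectrum ℝ T, ℝ) |
          IsUnit (algebraMap ℝ (X →L[ℝ] X) (g t) - Φ g)} := by
        refine Units.isOpen.preimage (f := fun g : C(spectrum ℝ T, ℝ) =>
          algebraMap ℝ (X →L[ℝ] X) (g t) - Φ g) ?_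
        have h1 : Continuous fun g : C(spectrum ℝ T, ℝ) => algebraMap ℝ (X →L[ℝ] X) (g t) :=
          (continuous_algebraMap ℝ (X →L[ℝ] X)).comp (continuous_eval_const t)
        exact h1.sub hiso.continuous
      have hd : Dense (polynomialFunctions (spectrum ℝ T) : Set C(spectrum ℝ T, ℝ)) := by
        rw [dense_iff_closure_eq, ← Subalgebra.topologicalClosure_coe,
          polynomialFunctions.topologicalClosure]
        rfl
      obtain ⟨g, hgp, hg⟩ := hd.exists_mem_open hopen ⟨f, hu⟩
      rw [polynomialFunctions_coe] at hgp
      obtain ⟨p, rfl⟩ := hgp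
      refine spectrum.subset_polynomial_aeval T p ⟨t, t.2, rfl⟩ ?_
      have : IsUnit (algebraMap ℝ (X →L[ℝ] X) (p.eval t) -
          Φ (p.toContinuousMapOn (spectrum ℝ T))) := hg
      rwa [hΦp] at this

/-- `cfc f T` is the operator `f(T)`, for `T` self-adjoint on a real Hilbert space and `f`
continuous on the spectrum of `T`. -/
instance instContinuousFunctionalCalculus :
    ContinuousFunctionalCalculus ℝ (X →L[ℝ] X) IsSelfAdjoint where
  predicate_zero := IsSelfAdjoint.zero _
  compactSpace_spectrum T := isCompact_iff_compactSpace.1 (spectrum.isCompact T)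
  spectrum_nonempty {_} T hT := by
    have : Nontrivial X := by
      by_contra h
      rw [not_nontrivial_iff_subsingleton] at h
      exact not_subsingleton (X →L[ℝ] X) inferInstance
    exact spectrum_nonempty_of_isSelfAdjoint hT
  exists_cfc_of_predicate _ hT := exists_cfc hT

section SpectralMeasure

open scoped ContinuousFunctionalCalculus CompactlySupported

theorem inner_cfcHom_nonneg {T : X →L[ℝ] X} (hT : IsSelfAdjoint T) (x : X)
    (f : C(spectrum ℝ T, ℝ)) (hf : 0 ≤ f) : 0 ≤ ⟪cfcHom hT f x, x⟫_ℝ := by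
  let g : C(spectrum ℝ T, ℝ) := ⟨fun t => √(f t), by fun_prop⟩
  have hg : f = g * g := by
    ext t
    exact (Real.mul_self_sqrt (hf t)).symm
  have h : ⟪cfcHom hT g (cfcHom hT g x), x⟫_ℝ = ⟪cfcHom hT g x, cfcHom hT g x⟫_ℝ :=
    (cfcHom_predicate hT g).isSymmetric _ _
  rw [hg, map_mul]
  exact (real_inner_self_nonneg).trans_eq h.symm

/-- The positive linear functional `f ↦ ⟨f(T) x, x⟩` on continuous functions on the spectrum. -/
noncomputable def spectralFunctional {T : X →L[ℝ] X} (hT : IsSelfAdjoint T) (x : X) :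
    C_c(spectrum ℝ T, ℝ) →ₚ[ℝ] ℝ :=
  PositiveLinearMap.mk₀
    { toFun := fun f => ⟪cfcHom hT (f : C(spectrum ℝ T, ℝ)) x, x⟫_ℝ
      map_add' := fun f g => by
        have : ((f + g : C_c(spectrum ℝ T, ℝ)) : C(spectrum ℝ T, ℝ)) = f + g := rfl
        rw [this, map_add, add_apply, inner_add_left]
      map_smul' := fun c f => by
        have : ((c • f : C_c(spectrum ℝ T, ℝ)) : C(spectrum ℝ T, ℝ)) = c • f := rfl
        rw [this, map_smul, smul_apply, real_inner_smul_left]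
        rfl }
    fun f hf => inner_cfcHom_nonneg hT x f hf

/-- The scalar spectral measure `μ_x` of the self-adjoint operator `T` at `x`: the Borel measure
on `ℝ`, carried by the spectrum of `T`, with `∫ f dμ_x = ⟨f(T) x, x⟩` for continuous `f`. -/
noncomputable def scalarSpectralMeasure {T : X →L[ℝ] X} (hT : IsSelfAdjoint T) (x : X) :
    Measure ℝ :=
  (RealRMK.rieszMeasure (spectralFunctional hT x)).map Subtype.val

instance isFiniteMeasure_scalarSpectralMeasure {T : X →L[ℝ] X} (hT : IsSelfAdjoint T) (x : X) :
    IsFiniteMeasure (scalarSpectralMeasure hT x) := by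
  unfold scalarSpectralMeasure
  infer_instance

theorem integral_scalarSpectralMeasure {T : X →L[ℝ] X} (hT : IsSelfAdjoint T) (x : X)
    {f : ℝ → ℝ} (hf : Continuous f) :
    ∫ t, f t ∂(scalarSpectralMeasure hT x) = ⟪cfc f T x, x⟫_ℝ := by
  rw [scalarSpectralMeasure, integral_map (by fun_prop) (by fun_prop)]
  have h := RealRMK.integral_rieszMeasure (spectralFunctional hT x)
    ⟨⟨fun t => f t, by fun_prop⟩, HasCompactSupport.of_compactSpace _⟩
  refine h.trans ?_
  rw [cfc_apply f T hT hf.continuousOn]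
  rfl

theorem scalarSpectralMeasure_univ {T : X →L[ℝ] X} (hT : IsSelfAdjoint T) (x : X) :
    (scalarSpectralMeasure hT x).real Set.univ = ‖x‖ ^ 2 := by
  have h := integral_scalarSpectralMeasure hT x (f := fun _ => 1) continuous_const
  rw [cfc_const_one ℝ T, one_apply_eq_self,
    real_inner_self_eq_norm_sq] at h
  simpa using h

/-- Linear relations between the quadratic forms `S ↦ ⟨S x_i, x_i⟩` carry over to the scalar
spectral measures. -/
theorem sum_scalarSpectralMeasure_eq_zero {T : X →L[ℝ] X} (hT : IsSelfAdjoint T) {n : ℕ}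
    (c : Fin n → ℝ) (x : Fin n → X)
    (h : ∀ S : X →L[ℝ] X, IsSelfAdjoint S → ∑ i, c i * ⟪S (x i), x i⟫_ℝ = 0) (A : Set ℝ) :
    ∑ i, c i * (scalarSpectralMeasure hT (x i)).real A = 0 := by
  have hsub : ∀ i, c i = (c i).toNNReal - (-c i).toNNReal := fun i => by
    simp
  have hm : ∑ i, (c i).toNNReal • scalarSpectralMeasure hT (x i) =
      ∑ i, (-c i).toNNReal • scalarSpectralMeasure hT (x i) := by
    refine ext_of_forall_integral_eq_of_IsFiniteMeasure fun f => ?_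
    rw [integral_finsetSum_measure fun i _ => f.integrable _,
      integral_finsetSum_measure fun i _ => f.integrable _, ← sub_eq_zero,
      ← Finset.sum_sub_distrib, ← h (cfc f T) (cfc_predicate _ _)]
    refine Finset.sum_congr rfl fun i _ => ?_
    rw [integral_smul_nnreal_measure, integral_smul_nnreal_measure,
      integral_scalarSpectralMeasure hT _ f.continuous, NNReal.smul_def, NNReal.smul_def,
      ← sub_smul, ← hsub, smul_eq_mul]
  have hA := congrArg (fun m : Measure ℝ => m.real A) hm
  simp only [Measure.real, Measure.finsetSum_apply, Measure.smul_apply,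
    ENNReal.smul_def, smul_eq_mul] at hA
  rw [ENNReal.toReal_sum (fun i _ => ENNReal.mul_ne_top ENNReal.coe_ne_top (measure_ne_top _ _)),
    ENNReal.toReal_sum (fun i _ => ENNReal.mul_ne_top ENNReal.coe_ne_top (measure_ne_top _ _)),
    ← sub_eq_zero, ← Finset.sum_sub_distrib] at hA
  rw [← hA]
  refine Finset.sum_congr rfl fun i _ => ?_
  conv_lhs => rw [hsub i, sub_mul]
  simp [Measure.real]

/-- The polarization `(μ_{x+y}(A) - μ_{x-y}(A)) / 4` of `x ↦ μ_x(A)`. -/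
noncomputable def spectralForm {T : X →L[ℝ] X} (hT : IsSelfAdjoint T) (A : Set ℝ) (x y : X) : ℝ :=
  ((scalarSpectralMeasure hT (x + y)).real A - (scalarSpectralMeasure hT (x - y)).real A) / 4

theorem spectralForm_comm {T : X →L[ℝ] X} (hT : IsSelfAdjoint T) (A : Set ℝ) (x y : X) :
    spectralForm hT A x y = spectralForm hT A y x := by
  have h := sum_scalarSpectralMeasure_eq_zero hT ![1, -1] ![x - y, y - x]
    (fun S _ => by simp [Fin.sum_univ_two, inner_sub_left, inner_sub_right]; ring) A
  simp [Fin.sum_univ_two] at h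
  rw [spectralForm, spectralForm, add_comm y x]
  linarith

theorem spectralForm_add (T : X →L[ℝ] X) (hT : IsSelfAdjoint T) (A : Set ℝ) (x x' y : X) :
    spectralForm hT A (x + x') y = spectralForm hT A x y + spectralForm hT A x' y := by
  have h := sum_scalarSpectralMeasure_eq_zero hT ![1, -1, -1, 1, -1, 1]
    ![x + x' + y, x + x' - y, x + y, x - y, x' + y, x' - y]
    (fun S _ => by
      simp [Fin.sum_univ_six, inner_sub_left, inner_sub_right, inner_add_left, inner_add_right]
      ring) A
  simp [Fin.sum_univ_six] at h
  simp only [spectralForm]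
  linarith

theorem spectralForm_smul (T : X →L[ℝ] X) (hT : IsSelfAdjoint T) (A : Set ℝ) (c : ℝ) (x y : X) :
    spectralForm hT A (c • x) y = c * spectralForm hT A x y := by
  have h := sum_scalarSpectralMeasure_eq_zero hT ![1, -1, -c, c]
    ![c • x + y, c • x - y, x + y, x - y]
    (fun S _ => by
      simp [Fin.sum_univ_four, inner_sub_left, inner_sub_right, inner_add_left, inner_add_right,
        real_inner_smul_left, real_inner_smul_right]
      ring) A
  simp [Fin.sum_univ_four] at h
  simp only [spectralForm]
  linarith

theorem spectralForm_self {T : X →L[ℝ] X} (hT : IsSelfAdjoint T) (A : Set ℝ) (x : X) :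
    spectralForm hT A x x = (scalarSpectralMeasure hT x).real A := by
  have h := sum_scalarSpectralMeasure_eq_zero hT ![1, -1, -4] ![x + x, x - x, x]
    (fun S _ => by
      simp [Fin.sum_univ_three, inner_add_left, inner_add_right]
      ring) A
  simp [Fin.sum_univ_three] at h
  simp only [spectralForm, sub_self]
  linarith

theorem abs_spectralForm_le {T : X →L[ℝ] X} (hT : IsSelfAdjoint T) (A : Set ℝ) (x y : X) :
    |spectralForm hT A x y| ≤ ‖x‖ * ‖y‖ := by
  have hle : ∀ z, (scalarSpectralMeasure hT z).real A ≤ ‖z‖ ^ 2 := fun z =>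
    scalarSpectralMeasure_univ hT z ▸ measureReal_mono (Set.subset_univ A)
  have hunit : ∀ u v : X, ‖u‖ = 1 → ‖v‖ = 1 → |spectralForm hT A u v| ≤ 1 := by
    intro u v hu hv
    have h1 := hle (u + v)
    have h2 := hle (u - v)
    have h3 : ‖u + v‖ ≤ 2 := (norm_add_le u v).trans (by rw [hu, hv]; norm_num)
    have h4 : ‖u - v‖ ≤ 2 := (norm_sub_le u v).trans (by rw [hu, hv]; norm_num)
    have h5 : 0 ≤ (scalarSpectralMeasure hT (u + v)).real A := measureReal_nonneg
    have h6 : 0 ≤ (scalarSpectralMeasure hT (u - v)).real A := measureReal_nonneg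
    rw [spectralForm, abs_le]
    constructor <;> nlinarith [norm_nonneg (u + v), norm_nonneg (u - v)]
  have hz : ∀ z, spectralForm hT A 0 z = 0 := fun z => by
    simpa using spectralForm_smul T hT A 0 0 z
  rcases eq_or_ne x 0 with rfl | hx
  · simp [hz]
  rcases eq_or_ne y 0 with rfl | hy
  · simp [spectralForm_comm hT A x 0, hz]
  have h := hunit (‖x‖⁻¹ • x) (‖y‖⁻¹ • y) (norm_smul_inv_norm hx) (norm_smul_inv_norm hy)
  rw [spectralForm_smul, spectralForm_comm, spectralForm_smul, spectralForm_comm, abs_mul, abs_mul,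
    abs_inv, abs_inv, abs_norm, abs_norm] at h
  have hx' := norm_pos_iff.2 hx
  have hy' := norm_pos_iff.2 hy
  rw [← div_eq_inv_mul, ← div_eq_inv_mul, div_div, div_le_one (by positivity)] at h
  linarith

/-- The spectral measure `A ↦ E_A` of the self-adjoint operator `T`: `E_A` is the bounded operator
determined by `⟨E_A x, x⟩ = μ_x(A)` and its polarization. -/
noncomputable def spectralMeasure {T : X →L[ℝ] X} (hT : IsSelfAdjoint T) (A : Set ℝ) :
    X →L[ℝ] X :=
  InnerProductSpace.continuousLinearMapOfBilin (𝕜 := ℝ)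
    (LinearMap.mkContinuous₂
      (LinearMap.mk₂ ℝ (spectralForm hT A) (spectralForm_add T hT A) (spectralForm_smul T hT A)
        (fun x y y' => by
          simp only [spectralForm_comm hT A x]
          exact spectralForm_add T hT A y y' x)
        (fun c x y => by
          simp only [spectralForm_comm hT A x]
          exact spectralForm_smul T hT A c y x))
      1 fun x y => by rw [one_mul]; exact abs_spectralForm_le hT A x y)

theorem inner_spectralMeasure {T : X →L[ℝ] X} (hT : IsSelfAdjoint T) (A : Set ℝ) (x y : X) :
    ⟪spectralMeasure hT A x, y⟫_ℝ = spectralForm hT A x y :=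
  InnerProductSpace.continuousLinearMapOfBilin_apply (𝕜 := ℝ) _ x y

theorem inner_spectralMeasure_self {T : X →L[ℝ] X} (hT : IsSelfAdjoint T) (A : Set ℝ) (x : X) :
    ⟪spectralMeasure hT A x, x⟫_ℝ = (scalarSpectralMeasure hT x).real A := by
  rw [inner_spectralMeasure, spectralForm_self]

end SpectralMeasure

variable {Y : Type*} [NormedAddCommGroup Y] [InnerProductSpace ℝ Y] [CompleteSpace Y]

theorem isSelfAdjoint_adjoint_comp (L : X →L[ℝ] Y) :
    IsSelfAdjoint (L.adjoint ∘L L) :=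
  (ContinuousLinearMap.isPositive_adjoint_comp_self L).isSelfAdjoint

/-- `xdag` is the minimum-norm solution of `L x = y`. -/
def IsMinimumNormSolution (L : X →L[ℝ] Y) (y : Y) (xdag : X) : Prop :=
  L xdag = y ∧ ∀ x : X, L x = y → ‖xdag‖ ≤ ‖x‖

/-- The spectral function `e(l) = ‖E_{[0,l]} xdag‖²`, where `E` is the spectral measure of
`L* L`. -/
noncomputable def spectralFunction (L : X →L[ℝ] Y) (xdag : X) (l : ℝ) : ℝ :=
  ‖spectralMeasure (isSelfAdjoint_adjoint_comp L) (Set.Icc 0 l) xdag‖ ^ 2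

end RealHilbert

open Filter Topology

namespace RealHilbert

/-! ### Scalar spectral measures, cutoffs and spectral projections -/

section ScalarSpectralMeasure

variable {X : Type*} [NormedAddCommGroup X] [InnerProductSpace ℝ X] [CompleteSpace X]

/-! Put `T = L* L`, `u = xdag` and let `μ` be the scalar spectral measure of `T` at `u`. Then `‖f(T)
u‖² = ∫ f² dμ` for continuous `f`, and `e(l) = μ [0, l]` (`norm_spectralMeasure_sq`), so statement
(i) is a decay condition on `μ` near `0`.

(i) ⇒ (ii), `inner_le_of_measureReal_le`: regularize at a level `s > 0`. With `k = 1 / max(φ, s)`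
and residual `r = 1 - φ k`, one has `u = r(T) u + φ(T) k(T) u`, hence `⟨u, x⟩ ≤ ‖r(T) u‖ ‖x‖ + ‖k(T)
u‖ ‖φ(T) x‖`. The residual lives on `{φ ≤ s}`, so its norm is `O(s^ν)` by (i); a dyadic
decomposition of the values of `φ` gives `‖k(T) u‖ = O(s^(ν-1))`, the series converging because `ν <
1` (`integral_inv_max_sq_le`). The choice `s = ‖φ(T) x‖ / ‖x‖` balances the two terms.

(ii) ⇒ (i), `measureReal_le_of_inner_le`: test (ii) with `x = E_[0,l] u`. There `‖φ(T) x‖ ≤ φ(l)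
‖x‖` and `⟨u, x⟩ = ‖x‖²`, so `‖x‖ ≤ C φ(l)^ν`. In the proof the projection is replaced by continuous
cutoffs that shrink to `[0, l]`. -/

theorem inner_cfc_cfc {T : X →L[ℝ] X} (hT : IsSelfAdjoint T) (x : X) {f g : ℝ → ℝ}
    (hf : Continuous f) (hg : Continuous g) :
    ⟪cfc f T x, cfc g T x⟫_ℝ = ∫ t, f t * g t ∂(scalarSpectralMeasure hT x) := by
  have h := integral_scalarSpectralMeasure hT x (f := fun t => g t * f t) (hg.mul hf)
  rw [cfc_mul g f T hg.continuousOn hf.continuousOn] at h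
  simp only [mul_comm (f _)]
  rw [h]
  exact ((cfc_predicate (p := IsSelfAdjoint) g T).isSymmetric (cfc f T x) x).symm

theorem norm_cfc_sq {T : X →L[ℝ] X} (hT : IsSelfAdjoint T) (x : X) {f : ℝ → ℝ}
    (hf : Continuous f) :
    ‖cfc f T x‖ ^ 2 = ∫ t, f t ^ 2 ∂(scalarSpectralMeasure hT x) := by
  rw [← real_inner_self_eq_norm_sq, inner_cfc_cfc hT x hf hf]
  simp only [pow_two]

theorem ae_mem_scalarSpectralMeasure {T : X →L[ℝ] X} (hT : IsSelfAdjoint T) (x : X) {A : Set ℝ}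
    (hA : MeasurableSet A) (h : spectrum ℝ T ⊆ A) : ∀ᵐ t ∂(scalarSpectralMeasure hT x), t ∈ A := by
  rw [scalarSpectralMeasure]
  refine (ae_map_iff (p := fun t => t ∈ A) (by fun_prop) hA).2 ?_
  exact Eventually.of_forall fun t => h t.2

/-- A continuous function with values in `[0, 1]` that is `1` on `A` and `0` outside the
`δ`-thickening of `A`. -/
noncomputable def cutoff (δ : ℝ) (A : Set ℝ) (t : ℝ) : ℝ :=
  (thickenedIndicatorAux δ A t).toReal

theorem continuous_cutoff {δ : ℝ} (hδ : 0 < δ) (A : Set ℝ) : Continuous (cutoff δ A) :=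
  NNReal.continuous_coe.comp (thickenedIndicator hδ A).continuous

theorem cutoff_nonneg (δ : ℝ) (A : Set ℝ) (t : ℝ) : 0 ≤ cutoff δ A t := ENNReal.toReal_nonneg

theorem cutoff_le_one (δ : ℝ) (A : Set ℝ) (t : ℝ) : cutoff δ A t ≤ 1 :=
  ENNReal.toReal_le_of_le_ofReal zero_le_one
    ((thickenedIndicatorAux_le_one δ A t).trans_eq ENNReal.ofReal_one.symm)

theorem cutoff_eq_one (δ : ℝ) {A : Set ℝ} {t : ℝ} (ht : t ∈ A) :
    cutoff δ A t = 1 := by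
  simp [cutoff, thickenedIndicatorAux_one δ A ht]

theorem cutoff_eq_zero {δ : ℝ} (hδ : 0 < δ) {A : Set ℝ} {t : ℝ} (ht : t ∉ Metric.thickening δ A) :
    cutoff δ A t = 0 := by
  simp [cutoff, thickenedIndicatorAux_zero hδ A ht]

theorem integrable_cutoff {δ : ℝ} (hδ : 0 < δ) (A : Set ℝ) (μ : Measure ℝ) [IsFiniteMeasure μ] :
    Integrable (cutoff δ A) μ :=
  Integrable.of_bound (continuous_cutoff hδ A).aestronglyMeasurable 1
    (Eventually.of_forall fun t => by
      rw [Real.norm_eq_abs, abs_of_nonneg (cutoff_nonneg _ _ _)]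
      exact cutoff_le_one _ _ _)

theorem integrable_cutoff_sq {δ : ℝ} (hδ : 0 < δ) (A : Set ℝ) (μ : Measure ℝ)
    [IsFiniteMeasure μ] : Integrable (fun t => cutoff δ A t ^ 2) μ :=
  Integrable.of_bound ((continuous_cutoff hδ A).pow 2).aestronglyMeasurable 1
    (Eventually.of_forall fun t => by
      rw [Real.norm_eq_abs, abs_of_nonneg (sq_nonneg _)]
      exact pow_le_one₀ (cutoff_nonneg _ _ _) (cutoff_le_one _ _ _))

theorem measureReal_le_integral_cutoff {δ : ℝ} (hδ : 0 < δ) {A : Set ℝ} (hA : MeasurableSet A)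
    (μ : Measure ℝ) [IsFiniteMeasure μ] : μ.real A ≤ ∫ t, cutoff δ A t ∂μ := by
  rw [← integral_indicator_one hA]
  refine integral_mono ((integrable_const (1 : ℝ)).indicator hA) (integrable_cutoff hδ A μ)
    fun t => ?_
  by_cases ht : t ∈ A
  · simp [ht, cutoff_eq_one δ ht]
  · simp [ht, cutoff_nonneg]

/-- Dominated convergence. The cutoffs converge pointwise to the indicator of the closure of `A`,
which is why `A` has to be closed. -/
theorem tendsto_integral_cutoff_mul {δ : ℕ → ℝ} (hδ : ∀ n, 0 < δ n)
    (hlim : Tendsto δ atTop (𝓝 0)) {A : Set ℝ} (hA : IsClosed A) (μ : Measure ℝ)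
    [IsFiniteMeasure μ] {u : ℝ → ℝ} (hu : Integrable u μ) :
    Tendsto (fun n => ∫ t, cutoff (δ n) A t * u t ∂μ) atTop
      (𝓝 (∫ t in A, u t ∂μ)) := by
  rw [← integral_indicator hA.measurableSet]
  refine tendsto_integral_of_dominated_convergence (fun t => ‖u t‖)
    (fun n => (continuous_cutoff (hδ n) A).aestronglyMeasurable.mul hu.1) hu.norm
    (fun n => Eventually.of_forall fun t => ?_) (Eventually.of_forall fun t => ?_)
  · rw [norm_mul, Real.norm_eq_abs, abs_of_nonneg (cutoff_nonneg _ _ _)]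
    exact mul_le_of_le_one_left (norm_nonneg _) (cutoff_le_one _ _ _)
  · have h := thickenedIndicator_tendsto_indicator_closure hδ hlim A
    rw [hA.closure_eq, tendsto_pi_nhds] at h
    have h2 := ((NNReal.continuous_coe.tendsto _).comp (h t)).mul_const (u t)
    have h3 : ((A.indicator (fun _ => (1 : NNReal)) t : NNReal) : ℝ) * u t = A.indicator u t := by
      by_cases ht : t ∈ A <;> simp [ht]
    rw [h3] at h2
    exact h2

/-- The quadratic forms converge to `μ_z(A)` for every `z`, and `E_A` is defined by polarizing
these; symmetry of `cfc` polarizes the approximants in the same way. -/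
theorem tendsto_inner_cfc_cutoff {T : X →L[ℝ] X} (hT : IsSelfAdjoint T) {δ : ℕ → ℝ}
    (hδ : ∀ n, 0 < δ n) (hlim : Tendsto δ atTop (𝓝 0)) {A : Set ℝ} (hA : IsClosed A) (x y : X) :
    Tendsto (fun n => ⟪cfc (cutoff (δ n) A) T x, y⟫_ℝ) atTop
      (𝓝 ⟪spectralMeasure hT A x, y⟫_ℝ) := by
  have hz : ∀ z, Tendsto (fun n => ⟪cfc (cutoff (δ n) A) T z, z⟫_ℝ) atTop
      (𝓝 ((scalarSpectralMeasure hT z).real A)) := fun z => by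
    have h := tendsto_integral_cutoff_mul hδ hlim hA (scalarSpectralMeasure hT z)
      (integrable_const 1)
    simp only [mul_one, integral_const, smul_eq_mul, measureReal_restrict_apply_univ] at h
    refine h.congr fun n => ?_
    rw [← integral_scalarSpectralMeasure hT z (continuous_cutoff (hδ n) A)]
  rw [inner_spectralMeasure, spectralForm]
  refine (((hz (x + y)).sub (hz (x - y))).div_const 4).congr fun n => ?_
  have hs : ⟪cfc (cutoff (δ n) A) T y, x⟫_ℝ = ⟪cfc (cutoff (δ n) A) T x, y⟫_ℝ := by
    rw [real_inner_comm]
    exact ((cfc_predicate (p := IsSelfAdjoint) (cutoff (δ n) A) T).isSymmetric x y).symm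
  simp only [map_add, map_sub, inner_add_left, inner_add_right, inner_sub_left, inner_sub_right, hs]
  ring

/-- This replaces the idempotence of `E_A`. With cutoffs `χ_n`, the products `⟨χ_m(T) x, χ_n(T) x⟩`
are integrals of `χ_m χ_n`. Letting `m → ∞` gives `⟨E_A x, χ_n(T) x⟩ = μ_x(A)`, since `χ_n = 1` on
`A`; then `n → ∞` gives `⟨E_A x, E_A x⟩`. -/
theorem norm_spectralMeasure_sq {T : X →L[ℝ] X} (hT : IsSelfAdjoint T) {A : Set ℝ}
    (hA : IsClosed A) (x : X) :
    ‖spectralMeasure hT A x‖ ^ 2 = (scalarSpectralMeasure hT x).real A := by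
  obtain ⟨δ, -, hδ, hlim⟩ := exists_seq_strictAnti_tendsto (0 : ℝ)
  have hcut : ∀ n, ⟪cfc (cutoff (δ n) A) T x, spectralMeasure hT A x⟫_ℝ =
      (scalarSpectralMeasure hT x).real A := fun n => by
    rw [real_inner_comm]
    refine tendsto_nhds_unique (tendsto_inner_cfc_cutoff hT hδ hlim hA x _) ?_
    have h := tendsto_integral_cutoff_mul hδ hlim hA (scalarSpectralMeasure hT x)
      (integrable_cutoff (hδ n) A _)
    rw [setIntegral_congr_fun hA.measurableSet
      (fun t ht => cutoff_eq_one (δ n) ht : Set.EqOn (cutoff (δ n) A) (fun _ => 1) A)] at h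
    simp only [integral_const, smul_eq_mul, measureReal_restrict_apply_univ, mul_one] at h
    refine h.congr fun m => ?_
    rw [inner_cfc_cfc hT x (continuous_cutoff (hδ m) A) (continuous_cutoff (hδ n) A)]
  have h := tendsto_inner_cfc_cutoff hT hδ hlim hA x (spectralMeasure hT A x)
  simp only [hcut] at h
  rw [← real_inner_self_eq_norm_sq]
  exact tendsto_nhds_unique h tendsto_const_nhds

/-- For `l < 0` the form of `l - T` is coercive: its absolute value is at least `-l ‖x‖²`, which
makes `l - T` invertible. -/
theorem spectrum_subset_Ici {T : X →L[ℝ] X} (hT : T.IsPositive) :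
    spectrum ℝ T ⊆ Set.Ici 0 := by
  intro l hl
  by_contra hneg
  rw [Set.mem_Ici, not_le] at hneg
  refine hl ?_
  refine ContinuousLinearMap.isUnit_of_forall_le_norm_inner_map _
    (c := ⟨-l, by linarith⟩) (neg_pos.2 hneg) fun x => ?_
  have h1 : 0 ≤ ⟪T x, x⟫_ℝ := hT.inner_nonneg_left x
  have h2 : ⟪(algebraMap ℝ (X →L[ℝ] X) l - T) x, x⟫_ℝ = l * ‖x‖ ^ 2 - ⟪T x, x⟫_ℝ := by
    simp [Algebra.algebraMap_eq_smul_one, inner_sub_left, real_inner_smul_left]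
  rw [h2]
  change ‖x‖ ^ 2 * (-l) ≤ |_|
  refine le_trans ?_ (neg_le_abs _)
  linarith

theorem exists_spectrum_subset_Icc {T : X →L[ℝ] X} (hT : T.IsPositive) :
    ∃ M, spectrum ℝ T ⊆ Set.Icc 0 M := by
  obtain ⟨M, hM⟩ := (spectrum.isCompact (𝕜 := ℝ) T).bddAbove
  exact ⟨M, fun t ht => ⟨spectrum_subset_Ici hT ht, hM ht⟩⟩

end ScalarSpectralMeasure

/-! ### Consequences of the decay of the distribution function -/

section Decay

variable {μ : Measure ℝ} [IsFiniteMeasure μ] {ψ : ℝ → ℝ} {C M ν : ℝ}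

/-- A power bound of the distribution function by `ψ` bounds the measure of sublevel sets. -/
theorem measureReal_sublevel_le (hψ : Continuous ψ) (hψ0 : ∀ t, 0 ≤ ψ t)
    (hM : ∀ᵐ t ∂μ, t ∈ Set.Icc 0 M) (hC : 0 ≤ C) (hν : 0 < ν)
    (h : ∀ l, 0 < l → μ.real (Set.Icc 0 l) ≤ C * ψ l ^ (2 * ν)) {s : ℝ} (hs : 0 ≤ s) :
    μ.real {t | ψ t ≤ s} ≤ C * s ^ (2 * ν) := by
  have hK : IsCompact ({t | ψ t ≤ s} ∩ Set.Icc 0 M) :=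
    isCompact_Icc.inter_left (isClosed_le hψ continuous_const)
  have hae : μ.real {t | ψ t ≤ s} = μ.real ({t | ψ t ≤ s} ∩ Set.Icc 0 M) := by
    refine measureReal_congr ?_
    filter_upwards [hM] with t ht
    exact propext ⟨fun h => ⟨h, ht⟩, fun h => h.1⟩
  rw [hae]
  rcases Set.eq_empty_or_nonempty ({t | ψ t ≤ s} ∩ Set.Icc 0 M) with he | hne
  · rw [he, measureReal_empty]
    positivity
  -- By compactness the sublevel set inside `[0, M]` contains its largest point `l`, so `ψ l ≤ s`
  -- and the set lies in `[0, l]`.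
  obtain ⟨l, ⟨hls, hl0, -⟩, hmax⟩ := hK.exists_isGreatest hne
  have hsub : μ.real ({t | ψ t ≤ s} ∩ Set.Icc 0 M) ≤ μ.real (Set.Icc 0 l) :=
    measureReal_mono fun t ht => ⟨ht.2.1, hmax ht⟩
  refine hsub.trans ?_
  -- The hypothesis covers only positive arguments and `l` may be `0`, so the bound is taken as a
  -- limit from the right.
  have hl : μ.real (Set.Icc 0 l) ≤ C * ψ l ^ (2 * ν) := by
    have hcont : ContinuousAt (fun r => C * ψ r ^ (2 * ν)) l :=
      (hψ.continuousAt.rpow_const (Or.inr (by positivity))).const_mul C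
    refine ge_of_tendsto (hcont.tendsto.mono_left (nhdsWithin_le_nhds (s := Set.Ioi l))) ?_
    filter_upwards [self_mem_nhdsWithin] with r hr
    exact (measureReal_mono (Set.Icc_subset_Icc_right (le_of_lt hr))).trans
      (h r (hl0.trans_lt hr))
  refine hl.trans (mul_le_mul_of_nonneg_left ?_ hC)
  exact Real.rpow_le_rpow (hψ0 l) hls (by positivity)

/-- Dyadic estimate of the truncated second negative moment of `ψ`. -/
theorem integral_inv_max_sq_le (hψ : Continuous ψ) (hmono : Monotone ψ)
    (hM : ∀ᵐ t ∂μ, t ∈ Set.Icc 0 M) (hC : 0 ≤ C) (hν1 : ν < 1)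
    (h : ∀ s, 0 < s → μ.real {t | ψ t ≤ s} ≤ C * s ^ (2 * ν)) {s : ℝ} (hs : 0 < s) :
    ∫ t, ((max (ψ t) s)⁻¹) ^ 2 ∂μ ≤
      C * 2 ^ (2 * ν) * (1 - (2 : ℝ) ^ (2 * ν - 2))⁻¹ * (s ^ (ν - 1)) ^ 2 := by
  -- Since `ψ ≤ ψ M` on `[0, M]`, only dyadic shells of index below `N` are met, and the sum is
  -- finite.
  obtain ⟨N, hN⟩ := pow_unbounded_of_one_lt (max (ψ M) s / s) (one_lt_two (α := ℝ))
  have hmeas : ∀ r, MeasurableSet {t | ψ t ≤ r} := fun r =>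
    (isClosed_le hψ continuous_const).measurableSet
  have hint : ∀ k : ℕ, Integrable
      ({t | ψ t ≤ 2 ^ (k + 1) * s}.indicator fun _ => ((2 ^ k * s)⁻¹) ^ 2) μ := fun k =>
    (integrable_const _).indicator (hmeas _)
  have hq0 : (0 : ℝ) < 2 ^ (2 * ν - 2) := by positivity
  have hq1 : (2 : ℝ) ^ (2 * ν - 2) < 1 :=
    Real.rpow_lt_one_of_one_lt_of_neg one_lt_two (by linarith)
  calc ∫ t, ((max (ψ t) s)⁻¹) ^ 2 ∂μ
      ≤ ∫ t, ∑ k ∈ Finset.range N,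
          {t | ψ t ≤ 2 ^ (k + 1) * s}.indicator (fun _ => ((2 ^ k * s)⁻¹) ^ 2) t ∂μ := by
        refine integral_mono_of_nonneg (Eventually.of_forall fun t => sq_nonneg _)
          (integrable_finsetSum _ fun k _ => hint k) ?_
        filter_upwards [hM] with t ht
        have hms : 1 ≤ max (ψ t) s / s := by rw [one_le_div hs]; exact le_max_right _ _
        -- The shell of `t`: `2^k s ≤ max (ψ t) s < 2^(k+1) s`. The `k`-th summand alone dominates
        -- the integrand at `t`.
        obtain ⟨k, hk1, hk2⟩ := exists_nat_pow_near hms (one_lt_two (α := ℝ))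
        rw [le_div_iff₀ hs] at hk1
        rw [div_lt_iff₀ hs] at hk2
        have hkN : k < N := by
          refine (pow_lt_pow_iff_right₀ (one_lt_two (α := ℝ))).1 (lt_of_le_of_lt ?_ hN)
          rw [le_div_iff₀ hs]
          exact hk1.trans (max_le_max (hmono ht.2) le_rfl)
        have hmem : t ∈ {t | ψ t ≤ 2 ^ (k + 1) * s} := (le_max_left _ _).trans hk2.le
        have hsingle := Finset.single_le_sum (s := Finset.range N) (f := fun k =>
          {t | ψ t ≤ 2 ^ (k + 1) * s}.indicator (fun _ => ((2 ^ k * s)⁻¹) ^ 2) t)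
          (fun j _ => Set.indicator_nonneg (fun _ _ => sq_nonneg _) t) (Finset.mem_range.2 hkN)
        refine le_trans ?_ hsingle
        simp only [Set.indicator_of_mem hmem]
        gcongr
    _ = ∑ k ∈ Finset.range N, μ.real {t | ψ t ≤ 2 ^ (k + 1) * s} * ((2 ^ k * s)⁻¹) ^ 2 := by
        rw [integral_finsetSum _ fun k _ => hint k]
        refine Finset.sum_congr rfl fun k _ => ?_
        rw [integral_indicator_const _ (hmeas _), smul_eq_mul]
    _ ≤ ∑ k ∈ Finset.range N,
          C * 2 ^ (2 * ν) * (s ^ (ν - 1)) ^ 2 * ((2 : ℝ) ^ (2 * ν - 2)) ^ k := by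
        refine Finset.sum_le_sum fun k _ => ?_
        refine (mul_le_mul_of_nonneg_right (h (2 ^ (k + 1) * s) (by positivity))
          (sq_nonneg _)).trans_eq ?_
        -- The measure contributes `(2^(k+1) s)^(2ν)` and the integrand `(2^k s)^(-2)`, which leaves
        -- a geometric term of ratio `2^(2ν-2) < 1`.
        have e1 : (2 ^ (k + 1) * s) ^ (2 * ν) =
            2 ^ (2 * ν) * ((2 : ℝ) ^ (2 * ν)) ^ k * (s ^ ν) ^ 2 := by
          rw [Real.mul_rpow (by positivity) hs.le, Real.rpow_pow_comm two_pos.le,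
            Real.rpow_pow_comm hs.le, ← Real.rpow_natCast_mul hs.le,
            ← Real.mul_rpow two_pos.le (by positivity), pow_succ', Nat.cast_two]
        have e2 : (2 : ℝ) ^ (2 * ν - 2) = 2 ^ (2 * ν) / 2 ^ 2 := by
          rw [Real.rpow_sub two_pos, Real.rpow_two]
        rw [e1, e2, Real.rpow_sub hs, Real.rpow_one, div_pow, div_pow, mul_inv, mul_pow, inv_pow,
          inv_pow, ← pow_mul, ← pow_mul, mul_comm k 2]
        ring
    _ = C * 2 ^ (2 * ν) * (s ^ (ν - 1)) ^ 2 *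
          ∑ k ∈ Finset.range N, ((2 : ℝ) ^ (2 * ν - 2)) ^ k := by rw [Finset.mul_sum]
    _ ≤ C * 2 ^ (2 * ν) * (s ^ (ν - 1)) ^ 2 * (1 - (2 : ℝ) ^ (2 * ν - 2))⁻¹ := by
        refine mul_le_mul_of_nonneg_left ?_ (by positivity)
        rw [← tsum_geometric_of_lt_one hq0.le hq1]
        exact (summable_geometric_of_lt_one hq0.le hq1).sum_le_tsum _ fun k _ => by positivity
    _ = _ := by ring

end Decay

/-- Optimizing `a s^ν n + b s^(ν-1) p` over `s > 0`. -/
theorem le_rpow_mul_rpow_of_forall_le {z a b n p ν : ℝ} (hn : 0 < n) (hp : 0 ≤ p) (hν : 0 < ν)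
    (h : ∀ s, 0 < s → z ≤ a * s ^ ν * n + b * s ^ (ν - 1) * p) :
    z ≤ (a + b) * p ^ ν * n ^ (1 - ν) := by
  rcases hp.eq_or_lt with rfl | hp
  -- For `p = 0` the balancing value of `s` would be `0`; letting `s → 0+` gives `z ≤ 0`.
  · rw [Real.zero_rpow hν.ne']
    have hcont : ContinuousAt (fun s : ℝ => a * s ^ ν * n) 0 :=
      (((continuousAt_id.rpow_const (Or.inr hν.le)).const_mul a).mul_const n)
    have hlim := hcont.tendsto.mono_left (nhdsWithin_le_nhds (s := Set.Ioi 0))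
    rw [Real.zero_rpow hν.ne'] at hlim
    have := ge_of_tendsto hlim (b := z) (by
      filter_upwards [self_mem_nhdsWithin] with s hs
      simpa using h s hs)
    linarith
  -- At `s = p / n` both `s^ν n` and `s^(ν-1) p` equal `p^ν n^(1-ν)`.
  · refine (h (p / n) (div_pos hp hn)).trans_eq ?_
    rw [Real.div_rpow hp.le hn.le, Real.div_rpow hp.le hn.le, Real.rpow_sub hp, Real.rpow_sub hn,
      Real.rpow_sub hn, Real.rpow_one, Real.rpow_one]
    field_simp

/-! ### The two implications for a general self-adjoint operator -/

section Equivalence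

variable {X : Type*} [NormedAddCommGroup X] [InnerProductSpace ℝ X] [CompleteSpace X]

theorem inner_le_of_measureReal_le {T : X →L[ℝ] X} (hT : T.IsPositive) (u : X) {ψ : ℝ → ℝ}
    (hψ : Continuous ψ) (hmono : Monotone ψ) (hψ0 : ∀ t, 0 ≤ ψ t) {ν : ℝ} (hν0 : 0 < ν)
    (hν1 : ν < 1) {C : ℝ} (hC : 0 < C)
    (h : ∀ l, 0 < l →
      (scalarSpectralMeasure hT.isSelfAdjoint u).real (Set.Icc 0 l) ≤ C * ψ l ^ (2 * ν)) :
    ∃ D : ℝ, 0 < D ∧ ∀ x : X, ⟪u, x⟫_ℝ ≤ D * ‖cfc ψ T x‖ ^ ν * ‖x‖ ^ (1 - ν) := by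
  have hsa := hT.isSelfAdjoint
  obtain ⟨M, hMs⟩ := exists_spectrum_subset_Icc hT
  have hM := ae_mem_scalarSpectralMeasure hsa u measurableSet_Icc hMs
  have hsub : ∀ s, 0 < s → (scalarSpectralMeasure hsa u).real {t | ψ t ≤ s} ≤ C * s ^ (2 * ν) :=
    fun s hs => measureReal_sublevel_le hψ hψ0 hM hC.le hν0 h hs.le
  have hq1 : (2 : ℝ) ^ (2 * ν - 2) < 1 :=
    Real.rpow_lt_one_of_one_lt_of_neg one_lt_two (by linarith)
  have hq2 := sub_pos.2 hq1
  set K := C * 2 ^ (2 * ν) * (1 - (2 : ℝ) ^ (2 * ν - 2))⁻¹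
  have hK : 0 < K := by positivity
  refine ⟨√C + √K, by positivity, fun x => ?_⟩
  rcases eq_or_ne x 0 with rfl | hx
  · rw [inner_zero_right]
    positivity
  refine le_rpow_mul_rpow_of_forall_le (norm_pos_iff.2 hx) (norm_nonneg _) hν0 fun s hs => ?_
  have hm : ∀ t, 0 < max (ψ t) s := fun t => lt_max_of_lt_right hs
  have hk : Continuous fun t => (max (ψ t) s)⁻¹ :=
    (hψ.max continuous_const).inv₀ fun t => (hm t).ne'
  have hr : Continuous fun t => 1 - ψ t * (max (ψ t) s)⁻¹ := continuous_const.sub (hψ.mul hk)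
  -- The splitting `1 = r + ψ k` with `k = 1 / max(ψ, s)`. The truncation at `s` keeps `k`
  -- continuous where `ψ` vanishes.
  have hone : cfc (fun t => 1 - ψ t * (max (ψ t) s)⁻¹) T +
      cfc ψ T * cfc (fun t => (max (ψ t) s)⁻¹) T = 1 := by
    rw [← cfc_mul ψ _ T hψ.continuousOn hk.continuousOn,
      ← cfc_add T (fun t => 1 - ψ t * (max (ψ t) s)⁻¹)
        (fun t => ψ t * (max (ψ t) s)⁻¹) hr.continuousOn (hψ.mul hk).continuousOn, ← cfc_const_one ℝ T]
    simp only [sub_add_cancel]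
  have hdecomp : u = cfc (fun t => 1 - ψ t * (max (ψ t) s)⁻¹) T u +
      cfc ψ T (cfc (fun t => (max (ψ t) s)⁻¹) T u) := by
    have := congrArg (fun S : X →L[ℝ] X => S u) hone
    exact this.symm
  have hsymm : ⟪cfc ψ T (cfc (fun t => (max (ψ t) s)⁻¹) T u), x⟫_ℝ =
      ⟪cfc (fun t => (max (ψ t) s)⁻¹) T u, cfc ψ T x⟫_ℝ :=
    (cfc_predicate (p := IsSelfAdjoint) ψ T).isSymmetric _ _
  have hlow : ‖cfc (fun t => 1 - ψ t * (max (ψ t) s)⁻¹) T u‖ ≤ √C * s ^ ν := by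
    refine abs_le_of_sq_le_sq' ?_ (by positivity) |>.2
    rw [norm_cfc_sq hsa u hr, mul_pow, Real.sq_sqrt hC.le, ← Real.rpow_mul_natCast hs.le,
      mul_comm ν]
    refine le_trans ?_ (hsub s hs)
    have hmeas : MeasurableSet {t | ψ t ≤ s} := (isClosed_le hψ continuous_const).measurableSet
    rw [← integral_indicator_one hmeas]
    refine integral_mono_of_nonneg (Eventually.of_forall fun t => sq_nonneg _)
      ((integrable_const (1 : ℝ)).indicator hmeas) (Eventually.of_forall fun t => ?_)
    -- The residual has values in `[0, 1]` and vanishes where `ψ > s`, so its square is at most the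
    -- indicator of `{ψ ≤ s}`.
    by_cases ht : ψ t ≤ s
    · have h1 : 0 ≤ ψ t * (max (ψ t) s)⁻¹ := mul_nonneg (hψ0 t) (inv_nonneg.2 (hm t).le)
      have h2 : ψ t * (max (ψ t) s)⁻¹ ≤ 1 := by
        rw [← div_eq_mul_inv, div_le_one (hm t)]
        exact le_max_left _ _
      simp only [Set.indicator, Set.mem_ofPred_eq, ht, if_true, Pi.one_apply]
      exact pow_le_one₀ (by linarith) (by linarith)
    · have : max (ψ t) s = ψ t := max_eq_left (not_le.1 ht).le
      have h0 : ψ t ≠ 0 := (hs.trans (not_le.1 ht)).ne'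
      simp [ht, this, h0]
  have hhigh : ‖cfc (fun t => (max (ψ t) s)⁻¹) T u‖ ≤ √K * s ^ (ν - 1) := by
    refine abs_le_of_sq_le_sq' ?_ (by positivity) |>.2
    rw [norm_cfc_sq hsa u hk, mul_pow, Real.sq_sqrt hK.le]
    exact integral_inv_max_sq_le hψ hmono hM hC.le hν1 hsub hs
  calc ⟪u, x⟫_ℝ = ⟪cfc (fun t => 1 - ψ t * (max (ψ t) s)⁻¹) T u, x⟫_ℝ +
        ⟪cfc (fun t => (max (ψ t) s)⁻¹) T u, cfc ψ T x⟫_ℝ := by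
        rw [← hsymm, ← inner_add_left, ← hdecomp]
    _ ≤ ‖cfc (fun t => 1 - ψ t * (max (ψ t) s)⁻¹) T u‖ * ‖x‖ +
        ‖cfc (fun t => (max (ψ t) s)⁻¹) T u‖ * ‖cfc ψ T x‖ :=
        add_le_add (real_inner_le_norm _ _) (real_inner_le_norm _ _)
    _ ≤ _ := by gcongr

theorem measureReal_le_of_inner_le {T : X →L[ℝ] X} (hT : IsSelfAdjoint T) (u : X) {ψ : ℝ → ℝ}
    (hψ : Continuous ψ) (hmono : Monotone ψ) (hψ0 : ∀ t, 0 ≤ ψ t) {ν : ℝ} (hν0 : 0 < ν)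
    {C : ℝ} (hC : 0 < C)
    (h : ∀ x : X, ⟪u, x⟫_ℝ ≤ C * ‖cfc ψ T x‖ ^ ν * ‖x‖ ^ (1 - ν)) (l : ℝ) :
    (scalarSpectralMeasure hT u).real (Set.Icc 0 l) ≤ C ^ 2 * ψ l ^ (2 * ν) := by
  have hδ : ∀ δ, 0 < δ →
      (scalarSpectralMeasure hT u).real (Set.Icc 0 l) ≤ C ^ 2 * ψ (l + δ) ^ (2 * ν) := by
    intro δ hδ
    set f := cutoff δ (Set.Icc 0 l)
    have hf : Continuous f := continuous_cutoff hδ _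
    set x := cfc f T u
    have ha : ⟪u, x⟫_ℝ = ∫ t, f t ∂(scalarSpectralMeasure hT u) := by
      rw [integral_scalarSpectralMeasure hT u hf, real_inner_comm]
    -- For a projection this would be an equality; for a cutoff `f² ≤ f` suffices.
    have hb : ‖x‖ ^ 2 ≤ ⟪u, x⟫_ℝ := by
      rw [ha, norm_cfc_sq hT u hf]
      refine integral_mono (integrable_cutoff_sq hδ _ _) (integrable_cutoff hδ _ _) fun t => ?_
      exact pow_le_of_le_one (cutoff_nonneg _ _ _) (cutoff_le_one _ _ _) two_ne_zero
    -- The cutoff vanishes outside the `δ`-thickening of `[0, l]`, where monotonicity gives `ψ ≤ ψ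
    -- (l + δ)`.
    have hψx : ‖cfc ψ T x‖ ≤ ψ (l + δ) * ‖x‖ := by
      refine abs_le_of_sq_le_sq' ?_ (mul_nonneg (hψ0 _) (norm_nonneg _)) |>.2
      have hmul : cfc ψ T x = cfc (fun t => ψ t * f t) T u := by
        rw [cfc_mul ψ f T hψ.continuousOn hf.continuousOn]
        rfl
      rw [hmul, mul_pow, norm_cfc_sq hT u (f := fun t => ψ t * f t) (hψ.mul hf), norm_cfc_sq hT u hf,
        ← integral_const_mul]
      refine integral_mono_of_nonneg (Eventually.of_forall fun t => sq_nonneg _)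
        ((integrable_cutoff_sq hδ _ _).const_mul _) (Eventually.of_forall fun t => ?_)
      change (ψ t * f t) ^ 2 ≤ ψ (l + δ) ^ 2 * f t ^ 2
      by_cases ht : t ∈ Metric.thickening δ (Set.Icc 0 l)
      · obtain ⟨r, hr, hd⟩ := Metric.mem_thickening_iff.1 ht
        rw [Real.dist_eq, abs_lt] at hd
        rw [mul_pow]
        have h0 := hψ0 t
        have h1 : ψ t ≤ ψ (l + δ) := hmono (by linarith [hr.2, hd.2])
        gcongr
      · have : f t = 0 := cutoff_eq_zero hδ ht
        simp [this]
    have hle : ⟪u, x⟫_ℝ ≤ C * ψ (l + δ) ^ ν * ‖x‖ := by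
      refine (h x).trans ?_
      rcases eq_or_ne x 0 with h0 | h0
      · simp [h0, hν0.ne']
      have hx := norm_pos_iff.2 h0
      calc C * ‖cfc ψ T x‖ ^ ν * ‖x‖ ^ (1 - ν)
          ≤ C * (ψ (l + δ) * ‖x‖) ^ ν * ‖x‖ ^ (1 - ν) := by gcongr
        _ = C * ψ (l + δ) ^ ν * (‖x‖ ^ ν * ‖x‖ ^ (1 - ν)) := by
          rw [Real.mul_rpow (hψ0 _) hx.le]; ring
        _ = C * ψ (l + δ) ^ ν * ‖x‖ := by rw [← Real.rpow_add hx]; simp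
    have hnorm : ‖x‖ ≤ C * ψ (l + δ) ^ ν := by
      rcases (norm_nonneg x).eq_or_lt with h0 | h0
      · rw [← h0]
        exact mul_nonneg hC.le (Real.rpow_nonneg (hψ0 _) _)
      · refine le_of_mul_le_mul_right ?_ h0
        rw [← pow_two]
        exact hb.trans hle
    have hpow : (C * ψ (l + δ) ^ ν) ^ 2 = C ^ 2 * ψ (l + δ) ^ (2 * ν) := by
      rw [mul_pow, ← Real.rpow_mul_natCast (hψ0 _), mul_comm ν]
      norm_cast
    rw [← hpow, pow_two]
    -- The bound on `‖x‖` is fed back into `⟨u, x⟩ ≤ C ψ(l + δ)^ν ‖x‖`, and `⟨u, x⟩ = ∫ f dμ`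
    -- dominates `μ [0, l]`; this is the source of `C ^ 2`.
    refine (measureReal_le_integral_cutoff hδ measurableSet_Icc _).trans ?_
    rw [← ha]
    exact hle.trans (mul_le_mul_of_nonneg_left hnorm
      (mul_nonneg hC.le (Real.rpow_nonneg (hψ0 _) _)))
  have hcont : ContinuousAt (fun δ => C ^ 2 * ψ (l + δ) ^ (2 * ν)) 0 :=
    ((hψ.comp (continuous_const.add continuous_id)).continuousAt.rpow_const
      (Or.inr (by positivity))).const_mul _
  have hlim := hcont.tendsto.mono_left (nhdsWithin_le_nhds (s := Set.Ioi 0))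
  rw [add_zero] at hlim
  exact ge_of_tendsto hlim (by filter_upwards [self_mem_nhdsWithin] with δ h using hδ δ h)

end Equivalence

end RealHilbert

open RealHilbert in
theorem proposition4p1 {X Y : Type*}
    [NormedAddCommGroup X] [InnerProductSpace ℝ X] [CompleteSpace X]
    [NormedAddCommGroup Y] [InnerProductSpace ℝ Y] [CompleteSpace Y]
    (L : X →L[ℝ] Y) (y : Y) (xdag : X)
    (hxdag : RealHilbert.IsMinimumNormSolution L y xdag)
    (φ : ℝ → ℝ) (hφ_nonneg : ∀ t, 0 ≤ t → 0 ≤ φ t)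
    (hφ_mono : MonotoneOn φ (Set.Ici 0)) (hφ_cont : ContinuousOn φ (Set.Ici 0))
    (ν : ℝ) (hν0 : 0 < ν) (hν1 : ν < 1) :
    (∃ C : ℝ, 0 < C ∧ ∀ l : ℝ, 0 < l →
        RealHilbert.spectralFunction L xdag l ≤ C * φ l ^ (2 * ν)) ↔
      ∃ C : ℝ, 0 < C ∧ ∀ x : X,
        inner ℝ xdag x ≤ C * ‖cfc φ (L.adjoint ∘L L) x‖ ^ ν * ‖x‖ ^ (1 - ν) := by
  have hT : (L.adjoint ∘L L).IsPositive := ContinuousLinearMap.isPositive_adjoint_comp_self L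
  -- Extending `φ` by the constant `φ 0` to the left makes it continuous, monotone and nonnegative
  -- on all of `ℝ`. The operator does not change, because the spectrum of `L* L` lies in `[0, ∞)`.
  set ψ : ℝ → ℝ := fun t => φ (max t 0)
  have hψ : Continuous ψ := hφ_cont.comp_continuous (by fun_prop) fun t => le_max_right t 0
  have hmono : Monotone ψ := fun s t hst =>
    hφ_mono (le_max_right s 0) (le_max_right t 0) (max_le_max hst le_rfl)
  have hψ0 : ∀ t, 0 ≤ ψ t := fun t => hφ_nonneg _ (le_max_right t 0)
  have hψφ : ∀ t, 0 ≤ t → ψ t = φ t := fun t ht => congrArg φ (max_eq_left ht)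
  have hcfc : cfc φ (L.adjoint ∘L L) = cfc ψ (L.adjoint ∘L L) :=
    cfc_congr fun t ht => (hψφ t (spectrum_subset_Ici hT ht)).symm
  have he : ∀ l, spectralFunction L xdag l =
      (scalarSpectralMeasure hT.isSelfAdjoint xdag).real (Set.Icc 0 l) := fun l =>
    norm_spectralMeasure_sq _ isClosed_Icc xdag
  rw [hcfc]
  constructor
  · rintro ⟨C, hC, h⟩
    refine inner_le_of_measureReal_le hT xdag hψ hmono hψ0 hν0 hν1 hC fun l hl => ?_
    rw [← he, hψφ l hl.le]
    exact h l hl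
  · rintro ⟨C, hC, h⟩
    refine ⟨C ^ 2, by positivity, fun l hl => ?_⟩
    rw [he, ← hψφ l hl.le]
    exact measureReal_le_of_inner_le hT.isSelfAdjoint xdag hψ hmono hψ0 hν0 hC h l
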